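/- Let $\lambda>0$ (wavelength), $\sigma_w^2>0$ (noise variance), and let $(\sigma_m^2)_{m\in\mathbb Z}$ be non-negative variances with finite sum $P=\sum_{m\in\mathbb Z}\sigma_m^2$. Let $\mathcal M\subset\mathbb Z$ be a finite set and let $\boldsymbol\beta=(\beta_m)_{m\in\mathcal M}$ have independent circular complex Gaussian components $\beta_m\sim\mathcal{CN}(0,\sigma_m^2)$. For a finite set $\mathcal S\subset\mathbb R$ of sensor positions let $$\hat{\boldsymbol f}_{\mathcal S}=\boldsymbol K_{\mathcal S}\boldsymbol\beta+\boldsymbol w,\qquad [\boldsymbol K_{\mathcal S}]_{x,m}=\operatorname{sinc}\bigl(m+\tfrac{2}{\lambda}x\bigr)\quad(x\in\mathcal S,\ m\in\mathcal M),\qquad \operatorname{sinc}(t)=\frac{\sin(\pi t)}{\pi t},$$ where $\boldsymbol w$ is independent of $\boldsymbol\beta$ and has independent components $w_x\sim\mathcal{CN}(0,\sigma_w^2)$, and let $I(\hat{\boldsymbol f}_{\mathcal S};\boldsymbol\beta)$ be the mutual information in nats. Let the aperture $\mathcal A\subset\mathbb R$ be a bounded interval, let $\delta>0$ and $c\in\mathbb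 R$, and let $\mathcal V=\{c+k\delta : k\in\mathbb Z\}\cap\mathcal A$ be the uniform $\delta$-spaced grid of positions in $\mathcal A$. Let $N\ge 0$ be an integer with $N\le|\mathcal V|$. Then $I(\hat{\boldsymbol f}_{\mathcal S};\boldsymbol\beta)<\infty$ for every finite $\mathcal S\subset\mathbb R$; there is a best on-grid design, that is, a maximizer $\mathcal S_d^\star$ of $I(\hat{\boldsymbol f}_{\mathcal S};\boldsymbol\beta)$ over the sets $\mathcal S\subseteq\mathcal V$ with $|\mathcal S|\le N$; and every such maximizer satisfies $$I(\hat{\boldsymbol f}_{\mathcal S_d^\star};\boldsymbol\beta)\ \le\ \sup_{\mathcal S\subseteq\mathcal A,\ |\mathcal S|\le N} I(\hat{\boldsymbol f}_{\mathcal S};\boldsymbol\beta)\ \le\ I(\hat{\boldsymbol f}_{\mathcal S_d^\star};\boldsymbol\beta)+N\log\Bigl(1+\frac{4\delta P(1+\delta)N^{3/2}}{\lambda\sigma_w^2}\Bigr).$$ In particular, if $\mathcal S^\star$ is a best continuous-aperture design, that is, a maximizer of $I(\hat{\boldsymbol f}_{\mathcal S};\boldsymbol\beta)$ over the sets $\mathcal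 S\subseteq\mathcal A$ with $|\mathcal S|\le N$, then $$I(\hat{\boldsymbol f}_{\mathcal S_d^\star};\boldsymbol\beta)\ \le\ I(\hat{\boldsymbol f}_{\mathcal S^\star};\boldsymbol\beta)\ \le\ I(\hat{\boldsymbol f}_{\mathcal S_d^\star};\boldsymbol\beta)+N\log\Bigl(1+\frac{4\delta P(1+\delta)N^{3/2}}{\lambda\sigma_w^2}\Bigr).$$ -/

import Mathlib

open MeasureTheory ProbabilityTheory
open scoped NNReal ENNReal

noncomputable section

/-- The circular complex Gaussian law `CN(0, v)`: the real and imaginary parts are independent real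
Gaussians with mean `0` and variance `v / 2` each. -/
def circularGaussian (v : ℝ≥0) : Measure ℂ :=
  ((gaussianReal 0 (v / 2)).prod (gaussianReal 0 (v / 2))).map
    (fun p : ℝ × ℝ => (⟨p.1, p.2⟩ : ℂ))

/-- The mutual information `I(X; Y)` (in nats) of two random variables: the Kullback-Leibler
divergence of their joint law from the product of their marginal laws. -/
def mutualInformation {Ω E F : Type*} [MeasurableSpace Ω] [MeasurableSpace E] [MeasurableSpace F]
    (X : Ω → E) (Y : Ω → F) (μ : Measure Ω) : ℝ≥0∞ :=
  InformationTheory.klDiv (μ.map (fun ω => (X ω, Y ω))) ((μ.map X).prod (μ.map Y))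

/-- The normalized sinc function, `sin (π x) / (π x)`, with value `1` at `0`. -/
def normalizedSinc (x : ℝ) : ℝ := Real.sinc (Real.pi * x)

/-- The matrix `K_S`: rows are indexed by the sensor positions `x ∈ S`, columns by the retained
frequencies `m ∈ M`, and the entries are `sinc (m + (2 / lam) x)`. -/
def sensingMatrix (lam : ℝ) (M : Finset ℤ) (S : Finset ℝ) : Matrix S M ℂ :=
  fun x m => ((normalizedSinc ((m : ℤ) + 2 / lam * (x : ℝ)) : ℝ) : ℂ)

/-- The joint law of the coefficient vector `β` and of the noise vector `w`: all the components are
independent, `β_m ∼ CN(0, v m)` for `m ∈ M`, and the noise at each sensor is `CN(0, s)`. -/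
def modelLaw (v : ℤ → ℝ≥0) (s : ℝ≥0) (M : Finset ℤ) (S : Finset ℝ) :
    Measure ((M → ℂ) × (S → ℂ)) :=
  (Measure.pi (fun m : M => circularGaussian (v m))).prod
    (Measure.pi (fun _ : S => circularGaussian s))

/-- The vector of measurements `K_S β + w`, as a random variable in `ω = (β, w)`. -/
def measurements (lam : ℝ) (M : Finset ℤ) (S : Finset ℝ) (ω : (M → ℂ) × (S → ℂ)) : S → ℂ :=
  (sensingMatrix lam M S).mulVec ω.1 + ω.2

/-- The mutual information between the measurements taken at the positions in `S` and the
coefficient vector `β`. -/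
def designInformation (lam : ℝ) (v : ℤ → ℝ≥0) (s : ℝ≥0) (M : Finset ℤ) (S : Finset ℝ) : ℝ≥0∞ :=
  mutualInformation (measurements lam M S) Prod.fst (modelLaw v s M S)

/-- The designs allowed over `A`: sets of at most `N` sensor positions in `A`. -/
def designs (A : Set ℝ) (N : ℕ) : Set (Finset ℝ) := {S | (S : Set ℝ) ⊆ A ∧ S.card ≤ N}

/-- `S` maximizes the objective `G` over the designs with at most `N` positions in `A`. -/
def IsOptimalDesign (G : Finset ℝ → ℝ≥0∞) (A : Set ℝ) (N : ℕ) (S : Finset ℝ) : Prop :=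
  S ∈ designs A N ∧ ∀ T ∈ designs A N, G T ≤ G S

/-- The uniform grid with spacing `δ` and offset `c` in `A`: all the points `c + k δ`, `k ∈ ℤ`,
that lie in `A`. -/
def uniformGrid (A : Set ℝ) (c δ : ℝ) : Set ℝ := {x | x ∈ A ∧ ∃ k : ℤ, x = c + k * δ}

end

/-! The channel is Gaussian, so the information of a design is `log det (1 + A Aᵀ)`, where the
columns of `A` are the sinc columns scaled by `√(v m / s)` (`mutualInformation_gaussianChannel`,
`designInformation_eq`). A design in the aperture is then compared with a nearby design on the grid.

Nearby grid designs exist by Hall's theorem: each point of the interval has at least `N` grid points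
within `N δ`, so at most `N` sensors can be moved to distinct grid points
(`exists_embedding_uniformGrid`).

The cost of the move is controlled by concavity of `log det`: with `X` and `Y` the two matrices, `tr
(Y⁻¹ X) ≤ n (1 + t)` gives `log det X ≤ log det Y + n log (1 + t)`. The excess of the trace over `n`
is a sum over columns of differences of quadratic forms, each equal to `(a - b) ⬝ᵥ Y⁻¹ (a + b)`.
Since `Y ≥ 1`, its inverse is a contraction, and Cauchy–Schwarz with Lipschitz bounds for sinc gives
the column estimate; summing the variances produces `P`. The stated constant leaves little room,
hence the sharp numerical bounds on the derivatives of sinc and of its square. -/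

/-! ### Lipschitz constants of sinc and of its square. -/

section Sinc

theorem nonneg_of_hasDerivAt_of_nonneg {f f' : ℝ → ℝ} (hf : ∀ t, HasDerivAt f (f' t) t)
    (h0 : 0 ≤ f 0) (h : ∀ t, 0 ≤ t → 0 ≤ f' t) {u : ℝ} (hu : 0 ≤ u) : 0 ≤ f u := by
  have hmono : MonotoneOn f (Set.Ici 0) := by
    refine monotoneOn_of_deriv_nonneg (convex_Ici 0)
      (fun t _ => (hf t).continuousAt.continuousWithinAt)
      (fun t _ => (hf t).differentiableAt.differentiableWithinAt) fun t ht => ?_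
    rw [(hf t).deriv]
    exact h t (interior_subset ht)
  exact h0.trans (hmono Set.self_mem_Ici hu hu)

theorem cos_le_taylor_four {t : ℝ} (ht : 0 ≤ t) :
    Real.cos t ≤ 1 - t ^ 2 / 2 + t ^ 4 / 24 := by
  have := nonneg_of_hasDerivAt_of_nonneg
    (f := fun t => 1 - t ^ 2 / 2 + t ^ 4 / 24 - Real.cos t)
    (f' := fun t => Real.sin t - (t - t ^ 3 / 6)) (fun t => by
      refine ((((hasDerivAt_const t (1 : ℝ)).sub ((hasDerivAt_pow 2 t).div_const 2)).add
        ((hasDerivAt_pow 4 t).div_const 24)).sub (Real.hasDerivAt_cos t)).congr_deriv ?_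
      push_cast; ring) (by simp) (fun t ht => sub_nonneg.2 (Real.sin_ge_sub_cube ht)) ht
  linarith

theorem sin_le_taylor_five {t : ℝ} (ht : 0 ≤ t) :
    Real.sin t ≤ t - t ^ 3 / 6 + t ^ 5 / 120 := by
  have := nonneg_of_hasDerivAt_of_nonneg
    (f := fun t => t - t ^ 3 / 6 + t ^ 5 / 120 - Real.sin t)
    (f' := fun t => 1 - t ^ 2 / 2 + t ^ 4 / 24 - Real.cos t) (fun t => by
      refine ((((hasDerivAt_id t).sub ((hasDerivAt_pow 3 t).div_const 6)).add
        ((hasDerivAt_pow 5 t).div_const 120)).sub (Real.hasDerivAt_sin t)).congr_deriv ?_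
      push_cast; ring) (by simp) (fun t ht => sub_nonneg.2 (cos_le_taylor_four ht)) ht
  linarith

theorem hasDerivAt_sin_sub_mul_cos (t : ℝ) :
    HasDerivAt (fun t => Real.sin t - t * Real.cos t) (t * Real.sin t) t := by
  refine ((Real.hasDerivAt_sin t).sub
    ((hasDerivAt_id t).mul (Real.hasDerivAt_cos t))).congr_deriv ?_
  simp

theorem sin_sub_mul_cos_le_cube {t : ℝ} (ht : 0 ≤ t) :
    Real.sin t - t * Real.cos t ≤ t ^ 3 / 3 := by
  have := nonneg_of_hasDerivAt_of_nonneg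
    (f := fun t => t ^ 3 / 3 - (Real.sin t - t * Real.cos t))
    (f' := fun t => t * (t - Real.sin t)) (fun t => by
      refine (((hasDerivAt_pow 3 t).div_const 3).sub
        (hasDerivAt_sin_sub_mul_cos t)).congr_deriv ?_
      push_cast; ring) (by simp) (fun t ht => mul_nonneg ht (sub_nonneg.2 (Real.sin_le ht))) ht
  linarith

theorem sin_sub_mul_cos_le_taylor {t : ℝ} (ht : 0 ≤ t) :
    Real.sin t - t * Real.cos t ≤ t ^ 3 / 3 - t ^ 5 / 30 + t ^ 7 / 840 := by
  have := nonneg_of_hasDerivAt_of_nonneg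
    (f := fun t => t ^ 3 / 3 - t ^ 5 / 30 + t ^ 7 / 840 - (Real.sin t - t * Real.cos t))
    (f' := fun t => t * (t - t ^ 3 / 6 + t ^ 5 / 120 - Real.sin t)) (fun t => by
      refine (((((hasDerivAt_pow 3 t).div_const 3).sub ((hasDerivAt_pow 5 t).div_const 30)).add
        ((hasDerivAt_pow 7 t).div_const 840)).sub (hasDerivAt_sin_sub_mul_cos t)).congr_deriv ?_
      push_cast; ring) (by simp)
      (fun t ht => mul_nonneg ht (sub_nonneg.2 (sin_le_taylor_five ht))) ht
  linarith

/-- The Taylor bounds for sine and cosine give the lower bound `t ^ 3 * (8 - t ^ 2) / 24`. -/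
theorem sin_sub_mul_cos_nonneg {t : ℝ} (ht : 0 ≤ t) (ht' : t ^ 2 ≤ 8) :
    0 ≤ Real.sin t - t * Real.cos t := by
  nlinarith [mul_le_mul_of_nonneg_left (cos_le_taylor_four ht) ht, Real.sin_ge_sub_cube ht,
    mul_nonneg (pow_nonneg ht 3) (sub_nonneg.2 ht')]

theorem abs_sin_sub_mul_cos_le {t : ℝ} (ht : 0 ≤ t) :
    |Real.sin t - t * Real.cos t| ≤ 9 / 20 * t ^ 2 := by
  rcases le_total t (5 / 2) with h | h
  · rw [abs_of_nonneg (sin_sub_mul_cos_nonneg ht (by nlinarith))]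
    have key : t / 3 - t ^ 3 / 30 + t ^ 5 / 840 ≤ 9 / 20 := by
      rcases le_total t (27 / 20) with h1 | h1
      · have : t ^ 2 * t ^ 3 ≤ 27 * t ^ 3 := by gcongr; nlinarith
        nlinarith [pow_nonneg ht 3]
      -- The polynomial peaks close to `43/20`, so squares vanishing there are the useful hints.
      · nlinarith [sq_nonneg (t - 43/20), mul_nonneg ht (sq_nonneg (t - 43/20)),
          mul_nonneg ht (sq_nonneg (t ^ 2 - (43/20)^2)), mul_nonneg (sub_nonneg.2 h) (sub_nonneg.2 h1)]
    nlinarith [sin_sub_mul_cos_le_taylor ht, mul_le_mul_of_nonneg_left key (sq_nonneg t)]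
  · refine abs_le_of_sq_le_sq ?_ (by positivity)
    have h1 := Real.sin_sq_add_cos_sq t
    -- Cauchy–Schwarz for `(1, -t)` and `(sin t, cos t)`; past `5/2` this crude bound suffices.
    have h2 : (Real.sin t - t * Real.cos t) ^ 2 ≤ 1 + t ^ 2 := by
      have h3 : (1 + t ^ 2) * (Real.sin t ^ 2 + Real.cos t ^ 2) = 1 + t ^ 2 := by
        rw [h1, mul_one]
      nlinarith [sq_nonneg (t * Real.sin t + Real.cos t)]
    have h3 : 25 / 4 ≤ t ^ 2 := by nlinarith
    nlinarith

/-- Divided by `t ^ 3`, the left side is the absolute derivative of sinc squared. Three regimes: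
`|sin t| ≤ t` near zero, `|sin t| ≤ 1` with the Taylor polynomial up to `19/10`, and trivial
trigonometric bounds beyond. -/
theorem abs_two_mul_sin_mul_le {t : ℝ} (ht : 0 < t) :
    |2 * Real.sin t * (Real.sin t - t * Real.cos t)| ≤ 159 / 250 * t ^ 3 := by
  rcases le_total t (19 / 10) with h | h
  · have hq := sin_sub_mul_cos_nonneg ht.le (by nlinarith)
    rw [abs_mul, abs_of_nonneg hq, abs_mul, abs_two]
    rcases le_total t (19 / 20) with h1 | h1
    · have hs : |Real.sin t| ≤ 19 / 20 :=
        Real.abs_sin_le_abs.trans (by rwa [abs_of_pos ht])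
      calc 2 * |Real.sin t| * (Real.sin t - t * Real.cos t)
          ≤ 2 * (19 / 20) * (t ^ 3 / 3) := by
            gcongr
            exact sin_sub_mul_cos_le_cube ht.le
        _ ≤ 159 / 250 * t ^ 3 := by nlinarith [pow_pos ht 3]
    · have key : 1 / 3 - t ^ 2 / 30 + t ^ 4 / 840 ≤ 159 / 500 := by
        have ha : 0 ≤ t ^ 2 - 361 / 400 := by nlinarith
        have hb : 0 ≤ 361 / 100 - t ^ 2 := by nlinarith
        nlinarith [mul_nonneg ha hb]
      calc 2 * |Real.sin t| * (Real.sin t - t * Real.cos t)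
          ≤ 2 * 1 * (t ^ 3 / 3 - t ^ 5 / 30 + t ^ 7 / 840) := by
            gcongr
            · exact Real.abs_sin_le_one t
            · exact sin_sub_mul_cos_le_taylor ht.le
        _ = 2 * t ^ 3 * (1 / 3 - t ^ 2 / 30 + t ^ 4 / 840) := by ring
        _ ≤ 2 * t ^ 3 * (159 / 500) := by gcongr
        _ = 159 / 250 * t ^ 3 := by ring
  · have h1 := Real.sin_sq_add_cos_sq t
    have h2 : |2 * Real.sin t * (Real.sin t - t * Real.cos t)| ≤ 2 + t := by
      rw [abs_le]
      constructor <;> nlinarith [mul_nonneg ht.le (sq_nonneg (Real.sin t + Real.cos t)),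
        mul_nonneg ht.le (sq_nonneg (Real.sin t - Real.cos t)), sq_nonneg (Real.sin t),
        sq_nonneg (Real.cos t), congrArg (t * ·) h1]
    have h3 : 361 / 100 ≤ t ^ 2 := by nlinarith
    nlinarith [mul_le_mul_of_nonneg_left h3 ht.le]

theorem hasDerivAt_sinc {t : ℝ} (ht : t ≠ 0) :
    HasDerivAt Real.sinc (-((Real.sin t - t * Real.cos t) / t ^ 2)) t := by
  have h : HasDerivAt (fun t => Real.sin t / t) (-((Real.sin t - t * Real.cos t) / t ^ 2)) t := by
    refine ((Real.hasDerivAt_sin t).div (hasDerivAt_id t) ht).congr_deriv ?_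
    simp only [id]
    ring
  refine h.congr_of_eventuallyEq ?_
  filter_upwards [isOpen_ne.mem_nhds ht] with u hu
  exact Real.sinc_of_ne_zero hu

/-- Evenness replaces the points by their absolute values, so the mean value theorem never needs the
derivative at zero. -/
theorem abs_sub_le_of_even_of_hasDerivAt {f f' : ℝ → ℝ} {C : ℝ} (hc : Continuous f)
    (heven : ∀ t, f (-t) = f t) (hf : ∀ t, 0 < t → HasDerivAt f (f' t) t)
    (hb : ∀ t, 0 < t → |f' t| ≤ C) (x y : ℝ) : |f x - f y| ≤ C * |x - y| := by
  have hC : 0 ≤ C := (abs_nonneg _).trans (hb 1 one_pos)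
  have habs : ∀ t, f |t| = f t := fun t => by
    rcases abs_choice t with h | h <;> simp [h, heven]
  have key : ∀ a b : ℝ, 0 ≤ a → a < b → |f b - f a| ≤ C * (b - a) := fun a b ha hab => by
    obtain ⟨c, hc1, hc2⟩ := exists_hasDerivAt_eq_slope f f' hab hc.continuousOn
      (fun t ht => hf t (ha.trans_lt ht.1))
    have h := hb c (ha.trans_lt hc1.1)
    rwa [hc2, abs_div, abs_of_pos (sub_pos.2 hab), div_le_iff₀ (sub_pos.2 hab)] at h
  rw [← habs x, ← habs y]
  refine le_trans ?_ (mul_le_mul_of_nonneg_left (abs_abs_sub_abs_le_abs_sub x y) hC)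
  rcases lt_trichotomy |x| |y| with h | h | h
  · rw [abs_sub_comm, abs_sub_comm |x|, abs_of_pos (sub_pos.2 h)]
    exact key _ _ (abs_nonneg x) h
  · simp [h]
  · rw [abs_of_pos (sub_pos.2 h)]
    exact key _ _ (abs_nonneg y) h

theorem abs_sinc_sub_sinc_le (x y : ℝ) :
    |Real.sinc x - Real.sinc y| ≤ 9 / 20 * |x - y| := by
  refine abs_sub_le_of_even_of_hasDerivAt Real.continuous_sinc Real.sinc_neg
    (fun t ht => hasDerivAt_sinc ht.ne') (fun t ht => ?_) x y
  rw [abs_neg, abs_div, abs_of_pos (pow_pos ht 2), div_le_iff₀ (pow_pos ht 2)]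
  exact abs_sin_sub_mul_cos_le ht.le

theorem abs_sinc_sq_sub_sinc_sq_le (x y : ℝ) :
    |Real.sinc x ^ 2 - Real.sinc y ^ 2| ≤ 159 / 250 * |x - y| := by
  refine abs_sub_le_of_even_of_hasDerivAt (f := fun t => Real.sinc t ^ 2)
    (Real.continuous_sinc.pow 2) (fun t => by simp [Real.sinc_neg])
    (fun t ht => (hasDerivAt_sinc ht.ne').pow 2) (fun t ht => ?_) x y
  have h : (2 : ℕ) * Real.sinc t ^ (2 - 1) * -((Real.sin t - t * Real.cos t) / t ^ 2) =
      -(2 * Real.sin t * (Real.sin t - t * Real.cos t) / t ^ 3) := by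
    rw [Real.sinc_of_ne_zero ht.ne']
    push_cast
    rw [pow_one]
    field_simp
  rw [h, abs_neg, abs_div, abs_of_pos (pow_pos ht 3), div_le_iff₀ (pow_pos ht 3)]
  exact abs_two_mul_sin_mul_le ht

theorem abs_normalizedSinc_le_one (x : ℝ) : |normalizedSinc x| ≤ 1 := Real.abs_sinc_le_one _

/-- The constant `9/20` was chosen so that `9π/20 < √2`; likewise `159/250` in the squared version,
where `159π/250 < 2`. -/
theorem abs_normalizedSinc_sub_le (x y : ℝ) :
    |normalizedSinc x - normalizedSinc y| ≤ √2 * |x - y| := by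
  refine (abs_sinc_sub_sinc_le _ _).trans ?_
  rw [← mul_sub, abs_mul, abs_of_pos Real.pi_pos, ← mul_assoc]
  gcongr
  refine Real.le_sqrt_of_sq_le ?_
  nlinarith [Real.pi_lt_d4, Real.pi_pos]

theorem abs_normalizedSinc_sq_sub_le (x y : ℝ) :
    |normalizedSinc x ^ 2 - normalizedSinc y ^ 2| ≤ 2 * |x - y| := by
  refine (abs_sinc_sq_sub_sinc_sq_le _ _).trans ?_
  rw [← mul_sub, abs_mul, abs_of_pos Real.pi_pos, ← mul_assoc]
  gcongr
  nlinarith [Real.pi_lt_d4]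

end Sinc

/-! ### Perturbation of `log det`. -/

section Matrix
open Matrix

variable {n m : Type*} [Fintype n] [DecidableEq n] [Fintype m]

theorem log_det_le_of_trace_le {X : Matrix n n ℝ} (hX : X.PosDef) {t : ℝ} (ht : 0 ≤ t)
    (htr : X.trace ≤ Fintype.card n * (1 + t)) :
    Real.log X.det ≤ Fintype.card n * Real.log (1 + t) := by
  have ht' : 0 < 1 + t := by linarith
  have hpos := fun i => hX.eigenvalues_pos i
  rw [hX.isHermitian.det_eq_prod_eigenvalues]
  rw [hX.isHermitian.trace_eq_sum_eigenvalues] at htr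
  simp only [RCLike.ofReal_real_eq_id, id_eq] at htr ⊢
  rw [Real.log_prod (fun i _ => (hpos i).ne')]
  -- The tangent line of the logarithm at `1 + t`, applied to each eigenvalue.
  have h : ∀ i, Real.log (hX.isHermitian.eigenvalues i) ≤
      hX.isHermitian.eigenvalues i / (1 + t) - 1 + Real.log (1 + t) := fun i => by
    have h1 := Real.log_le_sub_one_of_pos (div_pos (hpos i) ht')
    rw [Real.log_div (hpos i).ne' ht'.ne'] at h1
    linarith
  refine (Finset.sum_le_sum fun i _ => h i).trans ?_
  rw [Finset.sum_add_distrib, Finset.sum_sub_distrib, ← Finset.sum_div]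
  have h2 : (∑ i, hX.isHermitian.eigenvalues i) / (1 + t) ≤ Fintype.card n := by
    rwa [div_le_iff₀ ht']
  simp only [Finset.sum_const, Finset.card_univ, nsmul_eq_mul, mul_one]
  linarith

theorem posDef_one_add_mul_transpose (A : Matrix n m ℝ) : (1 + A * Aᵀ).PosDef := by
  refine PosDef.one.add_posSemidef ?_
  simpa using posSemidef_self_mul_conjTranspose A

theorem exists_transpose_mul_self_eq {X : Matrix n n ℝ} (hX : X.PosDef) :
    ∃ B : Matrix n n ℝ, Bᵀ * B = X := by
  classical
  open scoped MatrixOrder in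
  obtain ⟨B, hB⟩ := CStarAlgebra.nonneg_iff_eq_star_mul_self.mp hX.posSemidef.nonneg
  exact ⟨B, by simpa [star_eq_conjTranspose] using hB.symm⟩

theorem log_det_le_log_det_add {X Y : Matrix n n ℝ} (hX : X.PosDef) (hY : Y.PosDef) {t : ℝ}
    (ht : 0 ≤ t) (htr : (Y⁻¹ * X).trace ≤ Fintype.card n * (1 + t)) :
    Real.log X.det ≤ Real.log Y.det + Fintype.card n * Real.log (1 + t) := by
  obtain ⟨B, rfl⟩ := exists_transpose_mul_self_eq hY
  have hdet : (Bᵀ * B).det = B.det ^ 2 := by rw [det_mul, det_transpose, sq]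
  have hB : B.det ≠ 0 := fun h => hY.det_pos.ne' (by rw [hdet, h, sq, mul_zero])
  have hBu : IsUnit B.det := hB.isUnit
  -- Congruence by `B⁻¹` turns `Y = Bᵀ B` into the identity, leaving a positive definite matrix with
  -- the trace of `Y⁻¹ X`.
  set Z := (B⁻¹)ᵀ * X * B⁻¹ with hZ
  have hZpos : Z.PosDef := by
    have h := hX.conjTranspose_mul_mul_same (B := B⁻¹) (by
      rw [mulVec_injective_iff_isUnit]
      exact (isUnit_nonsing_inv_iff.2 ((isUnit_iff_isUnit_det _).2 hBu)))
    simpa [hZ] using h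
  have hZtr : Z.trace = ((Bᵀ * B)⁻¹ * X).trace := by
    rw [hZ, trace_mul_comm, ← Matrix.mul_assoc, Matrix.mul_inv_rev, transpose_nonsing_inv]
  have hZdet : X.det = (Bᵀ * B).det * Z.det := by
    rw [hdet, hZ, det_mul, det_mul, det_transpose, det_nonsing_inv, Ring.inverse_eq_inv']
    field_simp
  rw [hZdet, Real.log_mul hY.det_pos.ne' hZpos.det_pos.ne']
  have := log_det_le_of_trace_le hZpos ht (hZtr ▸ htr)
  linarith

/-- The inverse of `1 + A Aᵀ` is a contraction. -/
theorem dotProduct_inv_mulVec_le (A : Matrix n m ℝ) (u z : n → ℝ) :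
    u ⬝ᵥ ((1 + A * Aᵀ)⁻¹ *ᵥ z) ≤ √(u ⬝ᵥ u) * √(z ⬝ᵥ z) := by
  have hG := posDef_one_add_mul_transpose A
  set G := 1 + A * Aᵀ with hGdef
  set p := G⁻¹ *ᵥ z with hp
  have hz : G *ᵥ p = z := by
    rw [hp, mulVec_mulVec, mul_nonsing_inv _ hG.det_pos.ne'.isUnit, one_mulVec]
  have cs : ∀ a b : n → ℝ, a ⬝ᵥ b ≤ √(a ⬝ᵥ a) * √(b ⬝ᵥ b) := fun a b => by
    simpa [dotProduct, sq] using Real.sum_mul_le_sqrt_mul_sqrt Finset.univ a b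
  -- Here `p ⬝ᵥ z = |p|² + |Aᵀ p|²`; with Cauchy–Schwarz this yields `|p| ≤ |z|`.
  have hpz : p ⬝ᵥ p ≤ p ⬝ᵥ z := by
    rw [← hz, hGdef, add_mulVec, one_mulVec, dotProduct_add, ← mulVec_mulVec,
      dotProduct_mulVec p A, ← mulVec_transpose A]
    have : 0 ≤ (Aᵀ *ᵥ p) ⬝ᵥ (Aᵀ *ᵥ p) := Finset.sum_nonneg fun i _ => mul_self_nonneg _
    linarith
  have hple : √(p ⬝ᵥ p) ≤ √(z ⬝ᵥ z) := by
    have hpp : 0 ≤ p ⬝ᵥ p := Finset.sum_nonneg fun i _ => mul_self_nonneg _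
    rcases (Real.sqrt_nonneg (p ⬝ᵥ p)).eq_or_lt with h | h
    · rw [← h]; exact Real.sqrt_nonneg _
    · have := hpz.trans (cs p z)
      nth_rw 1 [← Real.mul_self_sqrt hpp] at this
      exact le_of_mul_le_mul_left this h
  exact (cs u p).trans (by gcongr)

/-- Perturbation bound for `log det (1 + A Aᵀ)` in terms of the columns of `A`. -/
theorem log_det_one_add_mul_transpose_le (A B : Matrix n m ℝ) {t : ℝ} (ht : 0 ≤ t)
    (h : ∑ j, ((A.col j) ⬝ᵥ ((1 + B * Bᵀ)⁻¹ *ᵥ A.col j) -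
      (B.col j) ⬝ᵥ ((1 + B * Bᵀ)⁻¹ *ᵥ B.col j)) ≤ Fintype.card n * t) :
    Real.log (1 + A * Aᵀ).det ≤
      Real.log (1 + B * Bᵀ).det + Fintype.card n * Real.log (1 + t) := by
  have hG := posDef_one_add_mul_transpose B
  refine log_det_le_log_det_add (posDef_one_add_mul_transpose A) hG ht ?_
  have htr : ∀ C : Matrix n m ℝ, ((1 + B * Bᵀ)⁻¹ * (C * Cᵀ)).trace =
      ∑ j, (C.col j) ⬝ᵥ ((1 + B * Bᵀ)⁻¹ *ᵥ C.col j) := fun C => by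
    rw [← Matrix.mul_assoc, trace_mul_comm]
    rfl
  have hone : ((1 + B * Bᵀ)⁻¹ * (1 + B * Bᵀ)).trace = (Fintype.card n : ℝ) := by
    rw [nonsing_inv_mul _ hG.det_pos.ne'.isUnit, trace_one]
  rw [mul_add, trace_add, htr] at hone ⊢
  rw [Finset.sum_sub_distrib] at h
  linarith

theorem dotProduct_inv_mulVec_sub_eq (B : Matrix n m ℝ) (a b : n → ℝ) :
    a ⬝ᵥ ((1 + B * Bᵀ)⁻¹ *ᵥ a) - b ⬝ᵥ ((1 + B * Bᵀ)⁻¹ *ᵥ b) =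
      (a - b) ⬝ᵥ ((1 + B * Bᵀ)⁻¹ *ᵥ (a + b)) := by
  have hsymm : ((1 + B * Bᵀ)⁻¹)ᵀ = (1 + B * Bᵀ)⁻¹ := by
    have := (posDef_one_add_mul_transpose B).inv.isHermitian.eq
    simpa using this
  have : a ⬝ᵥ ((1 + B * Bᵀ)⁻¹ *ᵥ b) = b ⬝ᵥ ((1 + B * Bᵀ)⁻¹ *ᵥ a) := by
    rw [dotProduct_mulVec, ← mulVec_transpose, hsymm, dotProduct_comm]
  rw [mulVec_add, dotProduct_add, sub_dotProduct, sub_dotProduct, this]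
  ring

end Matrix

/-! ### Densities of circular Gaussian vectors. -/

section GaussianDensity

theorem pi_withDensity_ofReal {ι E : Type*} [Fintype ι] [MeasurableSpace E] {ρ : Measure E}
    [SigmaFinite ρ] {g : E → ℝ} (hg : Integrable g ρ) (hg0 : ∀ z, 0 ≤ g z)
    [SigmaFinite (ρ.withDensity fun z => ENNReal.ofReal (g z))] :
    Measure.pi (fun _ : ι => ρ.withDensity fun z => ENNReal.ofReal (g z)) =
      (Measure.pi fun _ : ι => ρ).withDensity fun z => ENNReal.ofReal (∏ i, g (z i)) := by
  refine Measure.pi_eq fun s hs => ?_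
  rw [withDensity_apply _ (MeasurableSet.univ_pi hs), Measure.restrict_pi_pi,
    ← ofReal_integral_eq_lintegral_ofReal
      (Integrable.fintype_prod (f := fun _ => g) fun i => hg.restrict)
      (Filter.Eventually.of_forall fun z => Finset.prod_nonneg fun i _ => hg0 _),
    integral_fintype_prod_eq_prod (fun _ => g),
    ENNReal.ofReal_prod_of_nonneg fun i _ => integral_nonneg hg0]
  refine Finset.prod_congr rfl fun i _ => ?_
  rw [withDensity_apply _ (hs i), ofReal_integral_eq_lintegral_ofReal hg.restrict
    (Filter.Eventually.of_forall hg0)]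

/-- The density of `circularGaussian v`. -/
noncomputable def circularGaussianPDF (v : ℝ≥0) (z : ℂ) : ℝ :=
  gaussianPDFReal 0 (v / 2) z.re * gaussianPDFReal 0 (v / 2) z.im

theorem circularGaussian_eq_map (v : ℝ≥0) :
    circularGaussian v = ((gaussianReal 0 (v / 2)).prod (gaussianReal 0 (v / 2))).map
      Complex.measurableEquivRealProd.symm := rfl

instance isProbabilityMeasure_circularGaussian (v : ℝ≥0) :
    IsProbabilityMeasure (circularGaussian v) := by
  rw [circularGaussian_eq_map]
  exact Measure.isProbabilityMeasure_map (MeasurableEquiv.measurable _).aemeasurable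

theorem measurable_circularGaussianPDF (v : ℝ≥0) : Measurable (circularGaussianPDF v) :=
  ((measurable_gaussianPDFReal _ _).comp Complex.measurable_re).mul
    ((measurable_gaussianPDFReal _ _).comp Complex.measurable_im)

theorem circularGaussianPDF_pos {v : ℝ≥0} (hv : v ≠ 0) (z : ℂ) : 0 < circularGaussianPDF v z :=
  mul_pos (gaussianPDFReal_pos _ _ _ (by simpa using hv))
    (gaussianPDFReal_pos _ _ _ (by simpa using hv))

theorem integrable_circularGaussianPDF (v : ℝ≥0) : Integrable (circularGaussianPDF v) := by
  have h : Integrable (fun p : ℝ × ℝ =>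
      gaussianPDFReal 0 (v / 2) p.1 * gaussianPDFReal 0 (v / 2) p.2) :=
    (integrable_gaussianPDFReal 0 (v / 2)).mul_prod (integrable_gaussianPDFReal 0 (v / 2))
  exact Complex.volume_preserving_equiv_real_prod.integrable_comp_of_integrable h

theorem circularGaussian_eq_withDensity {v : ℝ≥0} (hv : v ≠ 0) :
    circularGaussian v =
      (volume : Measure ℂ).withDensity fun z => ENNReal.ofReal (circularGaussianPDF v z) := by
  have hv2 : v / 2 ≠ 0 := by simpa using hv
  refine Measure.ext_of_lintegral _ fun f hf => ?_
  have hd : Measurable fun p : ℝ × ℝ =>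
      gaussianPDF 0 (v / 2) p.1 * gaussianPDF 0 (v / 2) p.2 :=
    ((measurable_gaussianPDF _ _).comp measurable_fst).mul
      ((measurable_gaussianPDF _ _).comp measurable_snd)
  have hfe : Measurable fun p => f (Complex.measurableEquivRealProd.symm p) :=
    hf.comp (MeasurableEquiv.measurable _)
  rw [circularGaussian_eq_map, lintegral_map hf (MeasurableEquiv.measurable _),
    gaussianReal_of_var_ne_zero _ hv2,
    prod_withDensity (measurable_gaussianPDF _ _) (measurable_gaussianPDF _ _),
    lintegral_withDensity_eq_lintegral_mul _ hd hfe,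
    lintegral_withDensity_eq_lintegral_mul _ (measurable_circularGaussianPDF v).ennreal_ofReal hf,
    ← Complex.volume_preserving_equiv_real_prod.symm.lintegral_comp_emb
      (MeasurableEquiv.measurableEmbedding _)]
  refine lintegral_congr fun p => ?_
  simp only [Pi.mul_apply, gaussianPDF, circularGaussianPDF,
    ENNReal.ofReal_mul (gaussianPDFReal_nonneg _ _ _)]
  rfl

theorem integrable_log_gaussianPDFReal {v : ℝ≥0} (hv : v ≠ 0) :
    Integrable (fun x => Real.log (gaussianPDFReal 0 v x)) (gaussianReal 0 v) := by
  have h : ∀ x, Real.log (gaussianPDFReal 0 v x) =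
      Real.log (√(2 * Real.pi * v))⁻¹ - x ^ 2 / (2 * v) := fun x => by
    have : 0 < (v : ℝ) := by positivity
    rw [gaussianPDFReal, Real.log_mul (by positivity) (Real.exp_pos _).ne', Real.log_exp]
    ring
  simp_rw [h]
  refine (integrable_const _).sub (Integrable.div_const ?_ _)
  exact (memLp_id_gaussianReal' 2 (by simp)).integrable_sq

theorem integrable_log_circularGaussianPDF {v : ℝ≥0} (hv : v ≠ 0) :
    Integrable (fun z => Real.log (circularGaussianPDF v z)) (circularGaussian v) := by
  have hv2 : v / 2 ≠ 0 := by simpa using hv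
  rw [circularGaussian_eq_map, integrable_map_equiv]
  have h := integrable_log_gaussianPDFReal hv2
  refine ((h.comp_fst (gaussianReal 0 (v / 2))).add (h.comp_snd (gaussianReal 0 (v / 2)))).congr
    (Filter.Eventually.of_forall fun p => ?_)
  exact (Real.log_mul (gaussianPDFReal_pos _ _ _ hv2).ne' (gaussianPDFReal_pos _ _ _ hv2).ne').symm

end GaussianDensity

/-! ### Information through an additive-noise channel. -/

section AdditiveNoise

variable {E F : Type*} [NormedAddCommGroup E] [NormedSpace ℝ E] [FiniteDimensional ℝ E]
  [MeasurableSpace E] [BorelSpace E] [MeasurableSpace F]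
  {ρ : Measure E} [ρ.IsAddHaarMeasure] {γ : Measure E} {ν : Measure F} {g : E → ℝ}

theorem map_linearEquiv_withDensity (hg : Measurable g) (T : E ≃L[ℝ] E) :
    (ρ.withDensity fun w => ENNReal.ofReal (g w)).map T =
      ρ.withDensity fun y =>
        ENNReal.ofReal (|LinearMap.det (T : E →ₗ[ℝ] E)|⁻¹ * g (T.symm y)) := by
  have hdet : LinearMap.det (T : E →ₗ[ℝ] E) ≠ 0 := (LinearEquiv.isUnit_det' T.toLinearEquiv).ne_zero
  have hT : Measurable T := T.continuous.measurable
  have hTs : Measurable T.symm := T.symm.continuous.measurable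
  have hmap := Measure.map_linearMap_addHaar_eq_smul_addHaar ρ hdet
  rw [abs_inv] at hmap
  refine Measure.ext_of_lintegral _ fun f hf => ?_
  have hfT : Measurable fun w => f (T w) := hf.comp hT
  have hgT : Measurable fun y => ENNReal.ofReal (g (T.symm y)) := (hg.comp hTs).ennreal_ofReal
  have hgf : Measurable fun y => ENNReal.ofReal (g (T.symm y)) * f y := hgT.mul hf
  have hd : Measurable fun y =>
      ENNReal.ofReal (|LinearMap.det (T : E →ₗ[ℝ] E)|⁻¹ * g (T.symm y)) :=
    (measurable_const.mul (hg.comp hTs)).ennreal_ofReal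
  rw [lintegral_map hf hT, lintegral_withDensity_eq_lintegral_mul _ hg.ennreal_ofReal hfT,
    lintegral_withDensity_eq_lintegral_mul _ hd hf]
  have h1 : ∫⁻ y, ENNReal.ofReal (g (T.symm y)) * f y ∂(ρ.map T) =
      ∫⁻ w, ENNReal.ofReal (g w) * f (T w) ∂ρ := by
    rw [lintegral_map hgf hT]
    simp
  simp only [Pi.mul_apply]
  rw [← h1]
  change ∫⁻ y, _ ∂(ρ.map (T : E →ₗ[ℝ] E)) = _
  rw [hmap, lintegral_smul_measure, smul_eq_mul,
    ← lintegral_const_mul _ hgf]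
  refine lintegral_congr fun y => ?_
  rw [ENNReal.ofReal_mul (by positivity), mul_assoc]

theorem map_additiveNoise_eq_withDensity [SFinite ν] (hg : Measurable g) {Φ : F → E}
    (hΦ : Measurable Φ) [SFinite (ρ.withDensity fun w => ENNReal.ofReal (g w))] :
    (ν.prod (ρ.withDensity fun w => ENNReal.ofReal (g w))).map (fun ω => (Φ ω.1 + ω.2, ω.1)) =
      (ρ.prod ν).withDensity fun p => ENNReal.ofReal (g (p.1 - Φ p.2)) := by
  have hm : Measurable fun ω : F × E => (Φ ω.1 + ω.2, ω.1) := by fun_prop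
  have hm' : Measurable fun p : E × F => ENNReal.ofReal (g (p.1 - Φ p.2)) :=
    (hg.comp (measurable_fst.sub (hΦ.comp measurable_snd))).ennreal_ofReal
  refine Measure.ext_of_lintegral _ fun f hf => ?_
  have hfm : Measurable fun ω : F × E => f (Φ ω.1 + ω.2, ω.1) := hf.comp hm
  rw [lintegral_map hf hm, lintegral_prod _ hfm.aemeasurable,
    lintegral_withDensity_eq_lintegral_mul _ hm' hf,
    lintegral_prod_symm _ (hm'.mul hf).aemeasurable]
  refine lintegral_congr fun b => ?_
  rw [lintegral_withDensity_eq_lintegral_mul _ hg.ennreal_ofReal (by fun_prop)]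
  simpa using
    lintegral_add_left_eq_self (μ := ρ) (fun y => ENNReal.ofReal (g (y - Φ b)) * f (y, b)) (Φ b)

/-- The information carried by `Φ β + w` about `β`, when the law of `Φ β + w` is the image of the
law of the noise `w` under a linear automorphism `T`. -/
theorem klDiv_additiveNoise [IsProbabilityMeasure ν] [IsProbabilityMeasure γ]
    (hg : Measurable g) (hg0 : ∀ w, 0 < g w)
    (hγ : γ = ρ.withDensity fun w => ENNReal.ofReal (g w))
    (hlog : Integrable (fun w => Real.log (g w)) γ) {Φ : F → E} (hΦ : Measurable Φ)
    (T : E ≃L[ℝ] E) (hT : (ν.prod γ).map (fun ω => Φ ω.1 + ω.2) = γ.map T) :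
    InformationTheory.klDiv ((ν.prod γ).map fun ω => (Φ ω.1 + ω.2, ω.1)) ((γ.map T).prod ν) =
      ENNReal.ofReal (Real.log |LinearMap.det (T : E →ₗ[ℝ] E)|) := by
  set d := |LinearMap.det (T : E →ₗ[ℝ] E)| with hd
  have hd0 : 0 < d := abs_pos.2 (LinearEquiv.isUnit_det' T.toLinearEquiv).ne_zero
  have hTm : Measurable T := T.continuous.measurable
  have hTs : Measurable T.symm := T.symm.continuous.measurable
  have hX : Measurable fun ω : F × E => Φ ω.1 + ω.2 := by fun_prop
  have hm : Measurable fun ω : F × E => (Φ ω.1 + ω.2, ω.1) := by fun_prop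
  set J := (ν.prod γ).map fun ω => (Φ ω.1 + ω.2, ω.1) with hJ
  set R := (γ.map T).prod ν with hR
  have : IsProbabilityMeasure J := Measure.isProbabilityMeasure_map hm.aemeasurable
  have : IsProbabilityMeasure (γ.map T) := Measure.isProbabilityMeasure_map hTm.aemeasurable
  have hsf : IsProbabilityMeasure (ρ.withDensity fun w => ENNReal.ofReal (g w)) := hγ ▸ ‹_›
  -- Conditional density of the output given the input, over the marginal output density obtained by
  -- change of variables.
  let f : E × F → ℝ := fun p => g (p.1 - Φ p.2) / (d⁻¹ * g (T.symm p.1))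
  have hf0 : ∀ p, 0 < f p := fun p =>
    div_pos (hg0 _) (mul_pos (inv_pos.2 hd0) (hg0 _))
  have hr : Measurable fun y => d⁻¹ * g (T.symm y) := measurable_const.mul (hg.comp hTs)
  have hf : Measurable f :=
    (hg.comp (measurable_fst.sub (hΦ.comp measurable_snd))).div (hr.comp measurable_fst)
  have hJR : J = R.withDensity fun p => ENNReal.ofReal (f p) := by
    have hmap := map_linearEquiv_withDensity (ρ := ρ) hg T
    rw [← hγ, ← hd] at hmap
    have hr1 : Measurable fun p : E × F => ENNReal.ofReal (d⁻¹ * g (T.symm p.1)) :=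
      (hr.comp measurable_fst).ennreal_ofReal
    rw [hR, hmap, prod_withDensity_left hr.ennreal_ofReal,
      ← withDensity_mul _ hr1 hf.ennreal_ofReal, hJ, hγ,
      map_additiveNoise_eq_withDensity hg hΦ]
    congr 1
    funext p
    have hp : 0 < d⁻¹ * g (T.symm p.1) := mul_pos (inv_pos.2 hd0) (hg0 _)
    simp only [Pi.mul_apply]
    rw [← ENNReal.ofReal_mul hp.le, mul_div_cancel₀ _ hp.ne']
  have hac : J ≪ R := hJR ▸ withDensity_absolutelyContinuous _ _
  have hllr : llr J R =ᵐ[J] fun p => Real.log (f p) := by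
    have : J.rnDeriv R =ᵐ[R] fun p => ENNReal.ofReal (f p) := by
      rw [hJR]
      exact Measure.rnDeriv_withDensity R hf.ennreal_ofReal
    filter_upwards [hac this] with p hp
    rw [llr, hp, ENNReal.toReal_ofReal (hf0 p).le]
  have hlogf : ∀ ω : F × E, Real.log (f (Φ ω.1 + ω.2, ω.1)) =
      Real.log (g ω.2) - Real.log (g (T.symm (Φ ω.1 + ω.2))) + Real.log d := fun ω => by
    simp only [f]
    rw [add_sub_cancel_left, Real.log_div (hg0 _).ne' (mul_pos (inv_pos.2 hd0) (hg0 _)).ne',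
      Real.log_mul (inv_pos.2 hd0).ne' (hg0 _).ne', Real.log_inv]
    ring
  have hmp1 : MeasurePreserving (fun ω : F × E => ω.2) (ν.prod γ) γ := measurePreserving_snd
  have hmp2 : MeasurePreserving (fun ω : F × E => T.symm (Φ ω.1 + ω.2)) (ν.prod γ) γ := by
    refine ⟨hTs.comp hX, ?_⟩
    change (ν.prod γ).map (T.symm ∘ fun ω => Φ ω.1 + ω.2) = γ
    rw [← Measure.map_map hTs hX, hT, Measure.map_map hTs hTm]
    simp
  have hlogm : AEStronglyMeasurable (fun w => Real.log (g w)) γ := hg.log.aestronglyMeasurable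
  have hi1 : Integrable (fun ω => Real.log (g ω.2)) (ν.prod γ) :=
    hmp1.integrable_comp_of_integrable hlog
  have hi2 : Integrable (fun ω => Real.log (g (T.symm (Φ ω.1 + ω.2)))) (ν.prod γ) :=
    hmp2.integrable_comp_of_integrable hlog
  have hint : Integrable (fun p => Real.log (f p)) J := by
    rw [hJ, integrable_map_measure hf.log.aestronglyMeasurable hm.aemeasurable]
    refine ((hi1.sub hi2).add (integrable_const (Real.log d))).congr
      (Filter.Eventually.of_forall fun ω => ?_)
    exact (hlogf ω).symm
  rw [InformationTheory.klDiv_of_ac_of_integrable hac (hint.congr hllr.symm),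
    integral_congr_ae hllr, hJ, integral_map hm.aemeasurable hf.log.aestronglyMeasurable]
  simp_rw [hlogf]
  have he1 : ∫ ω, Real.log (g ω.2) ∂(ν.prod γ) = ∫ w, Real.log (g w) ∂γ := by
    conv_rhs => rw [← hmp1.map_eq]
    rw [integral_map hmp1.measurable.aemeasurable (by rwa [hmp1.map_eq])]
  have he2 : ∫ ω, Real.log (g (T.symm (Φ ω.1 + ω.2))) ∂(ν.prod γ) = ∫ w, Real.log (g w) ∂γ := by
    conv_rhs => rw [← hmp2.map_eq]
    rw [integral_map hmp2.measurable.aemeasurable (by rwa [hmp2.map_eq])]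
  have hi12 : Integrable
      (fun ω => Real.log (g ω.2) - Real.log (g (T.symm (Φ ω.1 + ω.2)))) (ν.prod γ) := hi1.sub hi2
  rw [integral_add hi12 (integrable_const _), integral_sub hi1 hi2, he1, he2, ← hJ]
  simp

end AdditiveNoise

/-! ### The output law by characteristic functions, and the log-determinant formula. -/

section CharacteristicFunction
open Matrix

theorem charFunDual_gaussianReal_zero (v : ℝ≥0) (L : StrongDual ℝ ℝ) :
    charFunDual (gaussianReal 0 v) L = Complex.exp (-((v * L 1 ^ 2 / 2 : ℝ) : ℂ)) := by
  have hL : ∀ x, L x = L 1 * x := fun x => by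
    rw [mul_comm, ← smul_eq_mul x, ← map_smul, smul_eq_mul, mul_one]
  have h : charFunDual (gaussianReal 0 v) L = charFun (gaussianReal 0 v) (L 1) := by
    rw [charFunDual_apply, charFun_apply]
    refine integral_congr_ae (Filter.Eventually.of_forall fun x => ?_)
    simp only [hL x]
    simp [mul_comm]
  rw [h, charFun_gaussianReal]
  congr 1
  push_cast
  ring

theorem charFunDual_circularGaussian (v : ℝ≥0) (L : StrongDual ℝ ℂ) :
    charFunDual (circularGaussian v) L =
      Complex.exp (-((v * (L 1 ^ 2 + L Complex.I ^ 2) / 4 : ℝ) : ℂ)) := by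
  have h : circularGaussian v = ((gaussianReal 0 (v / 2)).prod (gaussianReal 0 (v / 2))).map
      (Complex.equivRealProdCLM.symm : ℝ × ℝ →L[ℝ] ℂ) := rfl
  rw [h, charFunDual_map, charFunDual_prod, charFunDual_gaussianReal_zero,
    charFunDual_gaussianReal_zero, ← Complex.exp_add]
  have h1 : (Complex.equivRealProdCLM.symm (1, 0) : ℂ) = 1 := by
    simp [Complex.ext_iff]
  have h2 : (Complex.equivRealProdCLM.symm (0, 1) : ℂ) = Complex.I := by
    simp [Complex.ext_iff]
  simp only [ContinuousLinearMap.comp_apply, ContinuousLinearMap.inl_apply,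
    ContinuousLinearMap.inr_apply, ContinuousLinearEquiv.coe_coe, h1, h2]
  congr 1
  push_cast
  ring

variable {n m : Type*} [Fintype m]

/-- A real matrix acting on complex vectors, as a continuous real-linear map. -/
noncomputable def realMatrixCLM (A : Matrix n m ℝ) : (m → ℂ) →L[ℝ] (n → ℂ) :=
  LinearMap.toContinuousLinearMap
    ((Matrix.mulVecLin (A.map ((↑) : ℝ → ℂ))).restrictScalars ℝ)

theorem realMatrixCLM_apply (A : Matrix n m ℝ) (z : m → ℂ) :
    realMatrixCLM A z = A.map ((↑) : ℝ → ℂ) *ᵥ z := rfl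

theorem realMatrixCLM_realMatrixCLM (A B : Matrix m m ℝ) (z : m → ℂ) :
    realMatrixCLM A (realMatrixCLM B z) = realMatrixCLM (A * B) z := by
  have h : (A * B).map ((↑) : ℝ → ℂ) = A.map ((↑) : ℝ → ℂ) * B.map ((↑) : ℝ → ℂ) :=
    Matrix.map_mul (f := Complex.ofRealHom)
  rw [realMatrixCLM_apply, realMatrixCLM_apply, realMatrixCLM_apply, mulVec_mulVec, h]

variable [Fintype n] [DecidableEq n] [DecidableEq m]

theorem realMatrixCLM_single (A : Matrix n m ℝ) (L : StrongDual ℝ (n → ℂ)) (j : m) (z : ℂ) :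
    L (realMatrixCLM A (Pi.single j z)) = (Aᵀ *ᵥ fun i => L (Pi.single i z)) j := by
  have h : realMatrixCLM A (Pi.single j z) = ∑ i, A i j • (Pi.single i z : n → ℂ) := by
    rw [realMatrixCLM_apply, mulVec_single]
    funext i
    simp [Finset.sum_apply, Pi.single_apply, mul_comm]
  rw [h, map_sum]
  simp [mulVec, dotProduct]

theorem charFunDual_map_realMatrixCLM (v : m → ℝ≥0) (A : Matrix n m ℝ)
    (L : StrongDual ℝ (n → ℂ)) :
    charFunDual ((Measure.pi fun j => circularGaussian (v j)).map (realMatrixCLM A)) L =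
      Complex.exp (-(((∑ j, (v j : ℝ) * ((Aᵀ *ᵥ fun i => L (Pi.single i 1)) j ^ 2 +
        (Aᵀ *ᵥ fun i => L (Pi.single i Complex.I)) j ^ 2)) / 4 : ℝ) : ℂ)) := by
  rw [charFunDual_map, charFunDual_pi]
  simp only [charFunDual_circularGaussian]
  rw [← Complex.exp_sum]
  congr 1
  rw [Finset.sum_neg_distrib, Finset.sum_div]
  push_cast
  congr 1
  refine Finset.sum_congr rfl fun j _ => ?_
  rw [← realMatrixCLM_single, ← realMatrixCLM_single]
  rfl

theorem realMatrixCLM_one : realMatrixCLM (1 : Matrix n n ℝ) = ContinuousLinearMap.id ℝ _ := by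
  ext z i
  simp [realMatrixCLM_apply]

/-- Both laws are centred Gaussian, and `h` equates their covariance forms. It is applied twice, to
the values of a functional on the real and on the imaginary directions. Zero variances are allowed.
-/
theorem map_additiveNoise_eq_map_realMatrixCLM (v : m → ℝ≥0) (s : ℝ≥0) (K : Matrix n m ℝ)
    (T : Matrix n n ℝ)
    (h : ∀ a : n → ℝ, ∑ j, (v j : ℝ) * (Kᵀ *ᵥ a) j ^ 2 + ∑ i, (s : ℝ) * a i ^ 2 =
      ∑ i, (s : ℝ) * (Tᵀ *ᵥ a) i ^ 2) :
    ((Measure.pi fun j => circularGaussian (v j)).prod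
        (Measure.pi fun _ : n => circularGaussian s)).map
          (fun ω => realMatrixCLM K ω.1 + ω.2) =
      (Measure.pi fun _ : n => circularGaussian s).map (realMatrixCLM T) := by
  let Y : (m → ℂ) × (n → ℂ) →L[ℝ] (n → ℂ) :=
    (realMatrixCLM K).comp (ContinuousLinearMap.fst ℝ _ _) + ContinuousLinearMap.snd ℝ _ _
  have hY : (fun ω : (m → ℂ) × (n → ℂ) => realMatrixCLM K ω.1 + ω.2) = Y := rfl
  rw [hY]
  have := Measure.isProbabilityMeasure_map (μ := (Measure.pi fun j => circularGaussian (v j)).prod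
    (Measure.pi fun _ : n => circularGaussian s)) Y.measurable.aemeasurable
  have := Measure.isProbabilityMeasure_map (μ := Measure.pi fun _ : n => circularGaussian s)
    (realMatrixCLM T).measurable.aemeasurable
  refine Measure.ext_of_charFunDual (funext fun L => ?_)
  have h1 : (L.comp Y).comp (.inl ℝ _ _) = L.comp (realMatrixCLM K) := by
    ext z; simp [Y]
  have h2 : (L.comp Y).comp (.inr ℝ _ _) = L.comp (realMatrixCLM 1) := by
    ext z; simp [Y, realMatrixCLM_one]
  rw [charFunDual_map, charFunDual_prod, h1, h2, ← charFunDual_map, ← charFunDual_map,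
    charFunDual_map_realMatrixCLM, charFunDual_map_realMatrixCLM (fun _ => s),
    charFunDual_map_realMatrixCLM (fun _ => s), ← Complex.exp_add]
  congr 1
  rw [← neg_add, ← Complex.ofReal_add]
  congr 2
  rw [← add_div]
  congr 1
  simp only [mul_add, Finset.sum_add_distrib, transpose_one, one_mulVec]
  rw [← h, ← h]
  ring

/-- A real matrix acts separately on real and imaginary parts. The resulting square makes the
information a full `log det` rather than half of one. -/
theorem det_realMatrixCLM (T : Matrix n n ℝ) :
    LinearMap.det (realMatrixCLM T : (n → ℂ) →ₗ[ℝ] (n → ℂ)) = T.det ^ 2 := by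
  have h : (realMatrixCLM T : (n → ℂ) →ₗ[ℝ] (n → ℂ)) =
      (Matrix.toLin' (T.map ((↑) : ℝ → ℂ))).restrictScalars ℝ := rfl
  have h2 : (T.map ((↑) : ℝ → ℂ)).det = (T.det : ℂ) :=
    (RingHom.map_det Complex.ofRealHom T).symm
  rw [h, LinearMap.det_restrictScalars, LinearMap.det_toLin', h2, Algebra.norm_complex_apply,
    Complex.normSq_ofReal, sq]

/-- The real-linear automorphism of `n → ℂ` given by an invertible real matrix. -/
noncomputable def realMatrixCLE (T : Matrix n n ℝ) (hT : IsUnit T.det) : (n → ℂ) ≃L[ℝ] (n → ℂ) :=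
  ContinuousLinearEquiv.equivOfInverse (realMatrixCLM T) (realMatrixCLM T⁻¹)
    (fun z => by
      rw [realMatrixCLM_realMatrixCLM, nonsing_inv_mul _ hT, realMatrixCLM_one]; rfl)
    (fun z => by
      rw [realMatrixCLM_realMatrixCLM, mul_nonsing_inv _ hT, realMatrixCLM_one]; rfl)

theorem mutualInformation_gaussianChannel (v : m → ℝ≥0) {s : ℝ≥0} (hs : s ≠ 0) (K : Matrix n m ℝ) :
    mutualInformation (fun ω : (m → ℂ) × (n → ℂ) => realMatrixCLM K ω.1 + ω.2) Prod.fst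
      ((Measure.pi fun j => circularGaussian (v j)).prod
        (Measure.pi fun _ : n => circularGaussian s)) =
    ENNReal.ofReal (Real.log (1 + K * diagonal (fun j => ((v j / s : ℝ≥0) : ℝ)) * Kᵀ).det) := by
  set ν := Measure.pi fun j => circularGaussian (v j)
  set γ := Measure.pi fun _ : n => circularGaussian s with hγ
  set G := 1 + K * diagonal (fun j => ((v j / s : ℝ≥0) : ℝ)) * Kᵀ with hG
  have hGpos : G.PosDef := by
    refine PosDef.one.add_posSemidef ?_
    have := (PosSemidef.diagonal (n := m) (d := fun j => ((v j / s : ℝ≥0) : ℝ))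
      fun j => NNReal.coe_nonneg _).mul_mul_conjTranspose_same K
    simpa using this
  obtain ⟨B, hB⟩ := exists_transpose_mul_self_eq hGpos
  have hdet : G.det = Bᵀ.det ^ 2 := by rw [← hB, det_mul, det_transpose, sq]
  have hBu : IsUnit Bᵀ.det :=
    isUnit_iff_ne_zero.2 fun h => hGpos.det_pos.ne' (by rw [hdet, h, sq, mul_zero])
  have hs' : (s : ℝ) ≠ 0 := by exact_mod_cast hs
  -- Taking `T = Bᵀ` gives `T Tᵀ = G`, and `s G` is the covariance of the output.
  have hlaw : (ν.prod γ).map (fun ω => realMatrixCLM K ω.1 + ω.2) =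
      γ.map (realMatrixCLE Bᵀ hBu) := by
    refine map_additiveNoise_eq_map_realMatrixCLM v s K Bᵀ fun a => ?_
    have hquad : a ⬝ᵥ (G *ᵥ a) = (B *ᵥ a) ⬝ᵥ (B *ᵥ a) := by
      rw [← hB, ← mulVec_mulVec, dotProduct_mulVec, ← mulVec_transpose, transpose_transpose]
    rw [hG, add_mulVec, one_mulVec, dotProduct_add, ← mulVec_mulVec, ← mulVec_mulVec,
      dotProduct_mulVec a K, ← mulVec_transpose K] at hquad
    simp only [dotProduct, mulVec_diagonal, NNReal.coe_div] at hquad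
    rw [transpose_transpose, ← Finset.mul_sum, ← Finset.mul_sum]
    simp only [sq]
    rw [← hquad, mul_add, add_comm]
    congr 1
    rw [Finset.mul_sum]
    refine Finset.sum_congr rfl fun j _ => ?_
    field_simp
  have hfst : (ν.prod γ).map Prod.fst = ν := measurePreserving_fst.map_eq
  have hden : γ = (volume : Measure (n → ℂ)).withDensity
      fun z => ENNReal.ofReal (∏ i, circularGaussianPDF s (z i)) := by
    have hc := circularGaussian_eq_withDensity hs
    have : IsProbabilityMeasure ((volume : Measure ℂ).withDensity
      fun z => ENNReal.ofReal (circularGaussianPDF s z)) := hc ▸ inferInstance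
    rw [hγ, hc]
    exact pi_withDensity_ofReal (integrable_circularGaussianPDF s)
      fun z => (circularGaussianPDF_pos hs z).le
  have hpos : ∀ z : n → ℂ, 0 < ∏ i, circularGaussianPDF s (z i) := fun z =>
    Finset.prod_pos fun i _ => circularGaussianPDF_pos hs _
  have hmeas : Measurable fun z : n → ℂ => ∏ i, circularGaussianPDF s (z i) :=
    Finset.measurable_prod _ fun i _ =>
      (measurable_circularGaussianPDF s).comp (measurable_pi_apply i)
  have hlog : Integrable (fun z : n → ℂ => Real.log (∏ i, circularGaussianPDF s (z i))) γ := by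
    simp_rw [fun z : n → ℂ => Real.log_prod (s := Finset.univ)
      (f := fun i => circularGaussianPDF s (z i)) fun i _ => (circularGaussianPDF_pos hs _).ne']
    exact integrable_finsetSum _ fun i _ =>
      integrable_comp_eval (μ := fun _ : n => circularGaussian s) (i := i)
        (integrable_log_circularGaussianPDF hs)
  have key := klDiv_additiveNoise (ν := ν) hmeas hpos hden hlog
    (realMatrixCLM K).measurable (realMatrixCLE Bᵀ hBu) hlaw
  rw [mutualInformation, hfst, hlaw]
  refine key.trans ?_
  have hd : LinearMap.det (realMatrixCLE Bᵀ hBu : (n → ℂ) →ₗ[ℝ] (n → ℂ)) = Bᵀ.det ^ 2 :=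
    det_realMatrixCLM Bᵀ
  rw [hd, ← hdet, abs_of_pos hGpos.det_pos]

end CharacteristicFunction

/-! ### Information loss when sensors are displaced. -/

section Design
open Matrix

/-- The sensing matrix at positions `x`, with columns scaled by the prior standard deviations
relative to the noise. -/
noncomputable def scaledSensingMatrix {ι : Type*} (lam : ℝ) (v : ℤ → ℝ≥0) (s : ℝ≥0)
    (M : Finset ℤ) (x : ι → ℝ) : Matrix ι M ℝ :=
  fun i m => √(v m / s) * normalizedSinc ((m : ℤ) + 2 / lam * x i)

theorem designInformation_eq (lam : ℝ) (v : ℤ → ℝ≥0) {s : ℝ≥0} (hs : s ≠ 0) (M : Finset ℤ)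
    (S : Finset ℝ) :
    designInformation lam v s M S = ENNReal.ofReal (Real.log
      (1 + scaledSensingMatrix lam v s M ((↑) : S → ℝ) *
        (scaledSensingMatrix lam v s M ((↑) : S → ℝ))ᵀ).det) := by
  let K : Matrix S M ℝ := fun x m => normalizedSinc ((m : ℤ) + 2 / lam * (x : ℝ))
  refine (mutualInformation_gaussianChannel (fun m : M => v m) hs K).trans ?_
  congr 4
  have h : scaledSensingMatrix lam v s M ((↑) : S → ℝ) =
      K * diagonal (fun m : M => √(v m / s)) := by
    ext i m
    rw [mul_diagonal, mul_comm]
    rfl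
  rw [h, transpose_mul, diagonal_transpose, ← Matrix.mul_assoc, Matrix.mul_assoc K (diagonal _) (diagonal _),
    diagonal_mul_diagonal]
  congr 3
  funext m
  rw [NNReal.coe_div, Real.mul_self_sqrt (by positivity)]

/-- Lets the moved design keep the row labels of the original one, so that the two matrices can be
compared. -/
theorem designInformation_map_eq (lam : ℝ) (v : ℤ → ℝ≥0) {s : ℝ≥0} (hs : s ≠ 0) (M : Finset ℤ)
    {ι : Type*} [Fintype ι] [DecidableEq ι] (x : ι ↪ ℝ) :
    designInformation lam v s M (Finset.univ.map x) = ENNReal.ofReal (Real.log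
      (1 + scaledSensingMatrix lam v s M x * (scaledSensingMatrix lam v s M x)ᵀ).det) := by
  let e : ι ≃ (Finset.univ.map x : Finset ℝ) :=
    Equiv.ofBijective (fun i => ⟨x i, Finset.mem_map_of_mem x (Finset.mem_univ i)⟩)
      ⟨fun i j h => x.injective (congrArg Subtype.val h), fun ⟨y, hy⟩ => by
        obtain ⟨i, -, rfl⟩ := Finset.mem_map.1 hy
        exact ⟨i, rfl⟩⟩
  rw [designInformation_eq lam v hs, ← det_submatrix_equiv_self e]
  have he : ∀ i, ((e i : Finset.univ.map x) : ℝ) = x i := fun _ => rfl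
  congr 4
  ext i j
  simp [one_apply, Matrix.mul_apply, scaledSensingMatrix, he]

theorem sqrt_dotProduct_self_le {ι : Type*} [Fintype ι] {u : ι → ℝ} {c : ℝ} (hc : 0 ≤ c)
    (hu : ∀ i, |u i| ≤ c) : √(u ⬝ᵥ u) ≤ √(Fintype.card ι) * c := by
  rw [← Real.sqrt_sq hc, ← Real.sqrt_mul (Nat.cast_nonneg _)]
  refine Real.sqrt_le_sqrt ?_
  calc u ⬝ᵥ u ≤ ∑ _i : ι, c ^ 2 := Finset.sum_le_sum fun i _ => by
        rw [← sq, ← sq_abs]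
        exact pow_le_pow_left₀ (abs_nonneg _) (hu i) 2
    _ = _ := by simp

theorem col_quadraticForm_sub_le {ι : Type*} [Fintype ι] [DecidableEq ι] {lam : ℝ} (hlam : 0 < lam)
    (v : ℤ → ℝ≥0) (s : ℝ≥0) (M : Finset ℤ) {N : ℕ} (hN : 1 ≤ N) (hcard : Fintype.card ι ≤ N)
    {x y : ι → ℝ} {δ : ℝ} (hδ : 0 ≤ δ) (hxy : ∀ i, |x i - y i| ≤ N * δ) (m : M)
    (B : Matrix ι M ℝ) :
    (scaledSensingMatrix lam v s M x).col m ⬝ᵥ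
        ((1 + B * Bᵀ)⁻¹ *ᵥ (scaledSensingMatrix lam v s M x).col m) -
      (scaledSensingMatrix lam v s M y).col m ⬝ᵥ
        ((1 + B * Bᵀ)⁻¹ *ᵥ (scaledSensingMatrix lam v s M y).col m) ≤
      Fintype.card ι * (v m / s * (4 * δ * (N : ℝ) ^ (3 / 2 : ℝ) / lam)) := by
  rw [dotProduct_inv_mulVec_sub_eq]
  refine (dotProduct_inv_mulVec_le B _ _).trans ?_
  set r := √((v m : ℝ) / s) with hr
  have hr0 : 0 ≤ r := Real.sqrt_nonneg _
  have hr2 : r * r = v m / s := Real.mul_self_sqrt (by positivity)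
  have harg : ∀ i, |((m : ℤ) + 2 / lam * x i : ℝ) - ((m : ℤ) + 2 / lam * y i)| ≤
      2 / lam * (N * δ) := fun i => by
    rw [add_sub_add_left_eq_sub, ← mul_sub, abs_mul, abs_of_pos (by positivity)]
    gcongr
    exact hxy i
  -- The factors `√2` (Lipschitz) and `2` (sum) give `√2 N`, which `N ^ (3/2)` dominates only from
  -- `N = 2` on. For `N = 1` the form is scalar, and the Lipschitz constant `2` of sinc squared
  -- gives the required bound.
  rcases hN.eq_or_lt with h1 | h2
  · subst h1
    rcases isEmpty_or_nonempty ι with hι | ⟨⟨i₀⟩⟩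
    · simp [dotProduct]
    have hc1 : Fintype.card ι = 1 := le_antisymm hcard (Fintype.card_pos_iff.2 ⟨i₀⟩)
    have : Subsingleton ι := Fintype.card_le_one_iff_subsingleton.1 hc1.le
    let _ : Unique ι := uniqueOfSubsingleton i₀
    simp only [dotProduct, Fintype.sum_unique, Real.sqrt_mul_self_eq_abs]
    rw [← abs_mul]
    simp only [Pi.sub_apply, Pi.add_apply, col_apply, scaledSensingMatrix, ← hr]
    have := (abs_normalizedSinc_sq_sub_le _ _).trans
      (mul_le_mul_of_nonneg_left (harg default) two_pos.le)
    calc _ = (r * r) * |normalizedSinc ((m : ℤ) + 2 / lam * x default) ^ 2 -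
          normalizedSinc ((m : ℤ) + 2 / lam * y default) ^ 2| := by
          conv_rhs => rw [← abs_of_nonneg (mul_nonneg hr0 hr0), ← abs_mul]
          congr 1
          ring
      _ ≤ (r * r) * (2 * (2 / lam * ((1 : ℕ) * δ))) := by gcongr
      _ = _ := by
          rw [hr2, hc1]
          simp only [Nat.cast_one, Real.one_rpow]
          ring
  · have hsub : ∀ i, |((scaledSensingMatrix lam v s M x).col m -
        (scaledSensingMatrix lam v s M y).col m) i| ≤ r * (√2 * (2 / lam * (N * δ))) := fun i => by
      simp only [Pi.sub_apply, col_apply, scaledSensingMatrix, ← hr]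
      rw [← mul_sub, abs_mul, abs_of_nonneg hr0]
      gcongr
      exact (abs_normalizedSinc_sub_le _ _).trans (by gcongr; exact harg i)
    have hadd : ∀ i, |((scaledSensingMatrix lam v s M x).col m +
        (scaledSensingMatrix lam v s M y).col m) i| ≤ r * 2 := fun i => by
      simp only [Pi.add_apply, col_apply, scaledSensingMatrix, ← hr]
      rw [← mul_add, abs_mul, abs_of_nonneg hr0]
      gcongr
      exact (abs_add_le _ _).trans (by
        linarith [abs_normalizedSinc_le_one ((m : ℤ) + 2 / lam * x i),
          abs_normalizedSinc_le_one ((m : ℤ) + 2 / lam * y i)])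
    have hpow : √2 * N ≤ (N : ℝ) ^ (3 / 2 : ℝ) := by
      have hN0 : (0 : ℝ) < N := by exact_mod_cast hN
      have h2' : (2 : ℝ) ≤ N := by exact_mod_cast h2
      rw [show (3 / 2 : ℝ) = 1 / 2 + 1 by norm_num, Real.rpow_add_one hN0.ne', ← Real.sqrt_eq_rpow]
      gcongr
    calc _ ≤ (√(Fintype.card ι) * (r * (√2 * (2 / lam * (N * δ))))) *
          (√(Fintype.card ι) * (r * 2)) := by
          gcongr
          · exact sqrt_dotProduct_self_le (by positivity) hsub
          · exact sqrt_dotProduct_self_le (by positivity) hadd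
      _ = (√(Fintype.card ι) * √(Fintype.card ι)) * ((r * r) * (4 * δ * (√2 * N) / lam)) := by ring
      _ = Fintype.card ι * (v m / s * (4 * δ * (√2 * N) / lam)) := by
          rw [Real.mul_self_sqrt (Nat.cast_nonneg _), hr2]
      _ ≤ _ := by gcongr

theorem designInformation_le_of_displacement {lam : ℝ} (hlam : 0 < lam) {s : ℝ≥0} (hs : 0 < s)
    {v : ℤ → ℝ≥0} {P : ℝ} (hP : HasSum (fun m => (v m : ℝ)) P) (M : Finset ℤ) {N : ℕ}
    (hN : 1 ≤ N) {δ : ℝ} (hδ : 0 < δ) {S : Finset ℝ} (hS : S.card ≤ N) (y : S ↪ ℝ)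
    (hy : ∀ x : S, |(x : ℝ) - y x| ≤ N * δ) :
    designInformation lam v s M S ≤
      designInformation lam v s M (Finset.univ.map y) +
        ENNReal.ofReal (N * Real.log
          (1 + 4 * δ * P * (1 + δ) * (N : ℝ) ^ (3 / 2 : ℝ) / (lam * s))) := by
  have hs' : (0 : ℝ) < s := hs
  have hP0 : 0 ≤ P := hP.nonneg fun m => NNReal.coe_nonneg _
  have hsum : ∑ m : M, (v m : ℝ) ≤ P := by
    rw [Finset.sum_coe_sort M fun m => (v m : ℝ)]
    exact sum_le_hasSum M (fun m _ => NNReal.coe_nonneg _) hP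
  set t := 4 * δ * P * (1 + δ) * (N : ℝ) ^ (3 / 2 : ℝ) / (lam * s) with ht
  have ht0 : 0 ≤ t := by positivity
  rw [designInformation_eq lam v hs.ne', designInformation_map_eq lam v hs.ne']
  refine le_trans (ENNReal.ofReal_le_ofReal ?_) ENNReal.ofReal_add_le
  have hcard : Fintype.card S ≤ N := by rwa [Fintype.card_coe]
  refine (log_det_one_add_mul_transpose_le _ (scaledSensingMatrix lam v s M y) ht0 ?_).trans ?_
  · refine (Finset.sum_le_sum fun m _ =>
      col_quadraticForm_sub_le hlam v s M hN hcard hδ.le hy m _).trans ?_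
    rw [← Finset.mul_sum, ← Finset.sum_mul, ← Finset.sum_div]
    gcongr
    calc (∑ m : M, (v m : ℝ)) / s * (4 * δ * (N : ℝ) ^ (3 / 2 : ℝ) / lam)
        ≤ P / s * (4 * δ * (N : ℝ) ^ (3 / 2 : ℝ) / lam) := by gcongr
      _ = 4 * δ * P * 1 * (N : ℝ) ^ (3 / 2 : ℝ) / (lam * s) := by
          field_simp
      -- The factor `1 + δ` is pure slack here: only `1 ≤ 1 + δ` is needed.
      _ ≤ t := by
          rw [ht]
          gcongr
          linarith
  · gcongr
    exact Real.log_nonneg (by linarith)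

end Design

/-! ### Moving sensors to distinct grid points. -/

section Grid

theorem uniformGrid_subset (A : Set ℝ) (c δ : ℝ) : uniformGrid A c δ ⊆ A := fun _ h => h.1

theorem exists_finset_uniformGrid_near {A : Set ℝ} (hA : A.OrdConnected) {N : ℕ} {c δ : ℝ}
    (hδ : 0 < δ) (hV : (uniformGrid A c δ).Finite) (hN : N ≤ (uniformGrid A c δ).ncard)
    {x : ℝ} (hx : x ∈ A) :
    ∃ t : Finset ℝ, (t : Set ℝ) ⊆ uniformGrid A c δ ∧ (∀ y ∈ t, |x - y| ≤ N * δ) ∧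
      N ≤ t.card := by
  have hinj : ∀ k : ℤ, Function.Injective fun i : ℤ => c + (k + i : ℤ) * δ := fun k i j h => by
    have h' := mul_right_cancel₀ hδ.ne' (add_left_cancel h)
    exact add_left_cancel (Int.cast_injective h')
  by_cases hnear : ∀ y ∈ uniformGrid A c δ, |x - y| ≤ N * δ
  · refine ⟨hV.toFinset, by simp, fun y hy => hnear y (hV.mem_toFinset.1 hy), ?_⟩
    rwa [← Set.ncard_eq_toFinset_card _ hV]
  push Not at hnear
  obtain ⟨y, hy, hxy⟩ := hnear
  -- On the side of the far grid point `y`, the `N` lattice points strictly next to `x` lie between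
  -- `y` and `x`, hence in the interval `A`.
  rcases lt_abs.1 hxy with h | h
  · refine ⟨(Finset.Icc (-N : ℤ) (-1)).map ⟨_, hinj ⌈(x - c) / δ⌉⟩, ?_, ?_, by simp⟩
    all_goals
      have hk1 := Int.le_ceil ((x - c) / δ)
      have hk2 := Int.ceil_lt_add_one ((x - c) / δ)
      rw [div_le_iff₀ hδ] at hk1
      rw [← sub_lt_iff_lt_add, lt_div_iff₀ hδ] at hk2
      have hb : ∀ i ∈ Finset.Icc (-N : ℤ) (-1),
          x - N * δ ≤ c + (⌈(x - c) / δ⌉ + i : ℤ) * δ ∧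
            c + (⌈(x - c) / δ⌉ + i : ℤ) * δ ≤ x := fun i hi => by
        rw [Finset.mem_Icc] at hi
        have h1 : (-N : ℝ) ≤ i := by exact_mod_cast hi.1
        have h2 : (i : ℝ) ≤ -1 := by exact_mod_cast hi.2
        push_cast
        constructor <;> nlinarith
    · intro z hz
      obtain ⟨i, hi, rfl⟩ := Finset.mem_map.1 (Finset.mem_coe.1 hz)
      exact ⟨hA.out hy.1 hx ⟨by
        have := (hb i hi).1
        simp only [Function.Embedding.coeFn_mk]
        linarith, (hb i hi).2⟩, _, rfl⟩
    · intro z hz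
      obtain ⟨i, hi, rfl⟩ := Finset.mem_map.1 hz
      have := hb i hi
      simp only [Function.Embedding.coeFn_mk]
      rw [abs_of_nonneg (by linarith)]
      linarith
  · refine ⟨(Finset.Icc (1 : ℤ) N).map ⟨_, hinj ⌊(x - c) / δ⌋⟩, ?_, ?_, by simp⟩
    all_goals
      have hk1 := Int.floor_le ((x - c) / δ)
      have hk2 := Int.lt_floor_add_one ((x - c) / δ)
      rw [le_div_iff₀ hδ] at hk1
      rw [div_lt_iff₀ hδ] at hk2
      have hb : ∀ i ∈ Finset.Icc (1 : ℤ) N,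
          x ≤ c + (⌊(x - c) / δ⌋ + i : ℤ) * δ ∧
            c + (⌊(x - c) / δ⌋ + i : ℤ) * δ ≤ x + N * δ := fun i hi => by
        rw [Finset.mem_Icc] at hi
        have h1 : (1 : ℝ) ≤ i := by exact_mod_cast hi.1
        have h2 : (i : ℝ) ≤ N := by exact_mod_cast hi.2
        push_cast
        constructor <;> nlinarith
    · intro z hz
      obtain ⟨i, hi, rfl⟩ := Finset.mem_map.1 (Finset.mem_coe.1 hz)
      exact ⟨hA.out hx hy.1 ⟨(hb i hi).1, by
        have := (hb i hi).2
        simp only [Function.Embedding.coeFn_mk]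
        linarith⟩, _, rfl⟩
    · intro z hz
      obtain ⟨i, hi, rfl⟩ := Finset.mem_map.1 hz
      have := hb i hi
      simp only [Function.Embedding.coeFn_mk]
      rw [abs_of_nonpos (by linarith)]
      linarith

/-- At most `N` positions in `A` can be moved injectively to grid points, each by at most `N δ`. -/
theorem exists_embedding_uniformGrid {A : Set ℝ} (hA : A.OrdConnected) {N : ℕ} {c δ : ℝ}
    (hδ : 0 < δ) (hV : (uniformGrid A c δ).Finite) (hN : N ≤ (uniformGrid A c δ).ncard)
    {S : Finset ℝ} (hS : S ∈ designs A N) :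
    ∃ y : S ↪ ℝ, (∀ x, y x ∈ uniformGrid A c δ) ∧ ∀ x : S, |(x : ℝ) - y x| ≤ N * δ := by
  choose t ht1 ht2 ht3 using fun x : S =>
    exists_finset_uniformGrid_near hA hδ hV hN (hS.1 (Finset.mem_coe.2 x.2))
  -- Hall's condition is immediate: a single candidate set already has `N` elements, at least as
  -- many as there are sensors.
  obtain ⟨y, hy, hyt⟩ := (Finset.all_card_le_biUnion_card_iff_exists_injective t).1 fun U => by
    rcases U.eq_empty_or_nonempty with rfl | ⟨x, hx⟩
    · simp
    · calc U.card ≤ Fintype.card S := Finset.card_le_univ U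
        _ = S.card := Fintype.card_coe S
        _ ≤ N := hS.2
        _ ≤ (t x).card := ht3 x
        _ ≤ (U.biUnion t).card := Finset.card_le_card (Finset.subset_biUnion_of_mem t hx)
  exact ⟨⟨y, hy⟩, fun x => ht1 x (Finset.mem_coe.2 (hyt x)), fun x => ht2 x _ (hyt x)⟩

theorem uniformGrid_finite {A : Set ℝ} (hA : Bornology.IsBounded A) (c : ℝ) {δ : ℝ} (hδ : 0 < δ) :
    (uniformGrid A c δ).Finite := by
  obtain ⟨r, hr⟩ := hA.subset_closedBall c
  refine ((Set.finite_Icc (-⌈r / δ⌉) ⌈r / δ⌉).image fun k : ℤ => c + k * δ).subset ?_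
  rintro x ⟨hx, k, rfl⟩
  have h := hr hx
  rw [Metric.mem_closedBall, Real.dist_eq, add_sub_cancel_left, abs_mul, abs_of_pos hδ,
    ← le_div_iff₀ hδ, abs_le] at h
  have hc := Int.le_ceil (r / δ)
  refine ⟨k, ⟨?_, ?_⟩, rfl⟩
  · have : -(⌈r / δ⌉ : ℝ) ≤ k := by linarith
    exact_mod_cast this
  · have : (k : ℝ) ≤ ⌈r / δ⌉ := by linarith
    exact_mod_cast this

theorem exists_isOptimalDesign {V : Set ℝ} (hV : V.Finite) (G : Finset ℝ → ℝ≥0∞) (N : ℕ) :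
    ∃ S, IsOptimalDesign G V N S := by
  have hfin : (designs V N).Finite :=
    (hV.toFinset.powerset.finite_toSet).subset fun S hS => by
      simpa [Set.subset_def, Finset.subset_iff] using hS.1
  obtain ⟨S, hS, hmax⟩ := Set.exists_max_image _ G hfin ⟨∅, by simp [designs]⟩
  exact ⟨S, hS, hmax⟩

end Grid

/-! ### Comparison of optimal designs. -/

theorem lemma2
    (A : Set ℝ) (hA : A.OrdConnected) (hAb : Bornology.IsBounded A)
    (N : ℕ) (lam : ℝ) (hlam : 0 < lam) (s : ℝ≥0) (hs : 0 < s)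
    (v : ℤ → ℝ≥0) (P : ℝ) (hP : HasSum (fun m => (v m : ℝ)) P) (M : Finset ℤ)
    (c δ : ℝ) (hδ : 0 < δ) (hN : N ≤ (uniformGrid A c δ).ncard) :
    (∀ S : Finset ℝ, designInformation lam v s M S ≠ ∞) ∧
    (∃ Sd : Finset ℝ,
      IsOptimalDesign (designInformation lam v s M) (uniformGrid A c δ) N Sd) ∧
    ∀ Sd : Finset ℝ,
      IsOptimalDesign (designInformation lam v s M) (uniformGrid A c δ) N Sd →
      (designInformation lam v s M Sd ≤ ⨆ S ∈ designs A N, designInformation lam v s M S) ∧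
      ((⨆ S ∈ designs A N, designInformation lam v s M S) ≤
        designInformation lam v s M Sd +
          ENNReal.ofReal (N * Real.log
            (1 + 4 * δ * P * (1 + δ) * (N : ℝ) ^ (3 / 2 : ℝ) / (lam * s)))) ∧
      ∀ Sopt : Finset ℝ,
        IsOptimalDesign (designInformation lam v s M) A N Sopt →
        designInformation lam v s M Sd ≤ designInformation lam v s M Sopt ∧
        designInformation lam v s M Sopt ≤
          designInformation lam v s M Sd +
            ENNReal.ofReal (N * Real.log
              (1 + 4 * δ * P * (1 + δ) * (N : ℝ) ^ (3 / 2 : ℝ) / (lam * s))) := by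
  have hV := uniformGrid_finite hAb c hδ
  have hmono : ∀ S ∈ designs (uniformGrid A c δ) N, S ∈ designs A N := fun S hS =>
    ⟨hS.1.trans (uniformGrid_subset A c δ), hS.2⟩
  refine ⟨fun S => ?_, exists_isOptimalDesign hV _ N, fun Sd hSd => ?_⟩
  · rw [designInformation_eq lam v hs.ne']
    exact ENNReal.ofReal_ne_top
  -- Proved for every design in the aperture, so the supremum need not be attained.
  have hupper : ∀ S ∈ designs A N, designInformation lam v s M S ≤
      designInformation lam v s M Sd +
        ENNReal.ofReal (N * Real.log
          (1 + 4 * δ * P * (1 + δ) * (N : ℝ) ^ (3 / 2 : ℝ) / (lam * s))) := fun S hS => by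
    rcases N.eq_zero_or_pos with rfl | hN0
    · obtain rfl : S = ∅ := Finset.card_eq_zero.1 (Nat.le_zero.1 hS.2)
      exact le_add_right (hSd.2 ∅ ⟨by simp, by simp⟩)
    · obtain ⟨y, hyV, hy⟩ := exists_embedding_uniformGrid hA hδ hV hN hS
      refine (designInformation_le_of_displacement hlam hs hP M hN0 hδ hS.2 y hy).trans ?_
      gcongr
      refine hSd.2 _ ⟨fun z hz => ?_, by simpa using hS.2⟩
      obtain ⟨x, -, rfl⟩ := Finset.mem_map.1 (Finset.mem_coe.1 hz)
      exact hyV x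
  exact ⟨le_iSup₂_of_le Sd (hmono Sd hSd.1) le_rfl, iSup₂_le hupper, fun Sopt hopt =>
    ⟨hopt.2 Sd (hmono Sd hSd.1), hupper Sopt hopt.1⟩⟩
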